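/- **Lemma (Lightlike coordinates).** Let $M$ be a smooth $4$-dimensional manifold, let $A\subset TM\setminus\mathbf 0$ be open, connected and conic ($\lambda v\in A$ for $v\in A$, $\lambda>0$), with smooth boundary in $TM\setminus\mathbf 0$ and with $A\cap T_pM\neq\emptyset$ for every $p\in M$, and let $\bar A$ be its closure in $TM\setminus\mathbf 0$. Let $L\colon\bar A\to[0,\infty)$ be a Finsler spacetime structure: $L$ is smooth (i.e. it extends to a smooth function on an open neighbourhood of $\bar A$), $L(\lambda v)=\lambda^2L(v)$ for $\lambda>0$, the boundary of $\bar A$ in $TM\setminus\mathbf 0$ is $L^{-1}(0)$, and for each $v\in\bar A$ the fundamental tensor $$g_v(u,w)=\tfrac12\,\tfrac{\partial^2}{\partial s\,\partial t}L(v+tu+sw)\Big|_{t=s=0},\qquad u,w\in T_{\pi(v)}M,$$ has signature $(+,-,-,-)$. Let $f$ be a smooth function on an open set $\mathscr U\subseteq M$ that has a gradient $N=\nabla f$ there, i.e. a smooth vector field $N$ on $\mathscr U$ with values in $\bar A$ such that $g_N(N,X)=df(X)$ for all $X$. Suppose $N$ is lightlike: $N$ vanishes nowhere and $L(N)=0$.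 Then around every point of $\mathscr U$ there are smooth coordinates $(x^0,x^1,x^2,x^3)$, defined on an open subset of $\mathscr U$, such that throughout their domain $N=\partial_0$ and, with $g_{ij}(N)=g_N(\partial_i,\partial_j)$, $$(g_{ij}(N))=\begin{pmatrix}0&1&0&0\\1&g_{11}(N)&g_{12}(N)&g_{13}(N)\\0&g_{21}(N)&h_{22}&h_{23}\\0&g_{31}(N)&h_{32}&h_{33}\end{pmatrix},$$ where the symmetric $2\times2$ matrix $(h_{ij})$ is negative definite. The same holds in the opposite signature convention, i.e. when $L\colon\bar A\to(-\infty,0]$ is such that $-L$ satisfies the assumptions above (so that $g_v$ has signature $(-,+,+,+)$), with $g$, $\nabla f$ and $g_{ij}(N)$ still formed from $L$; in that case $(h_{ij})$ is positive definite. -/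

import Mathlib

open scoped Manifold ContDiff

noncomputable section

/-- The model space `ℝ⁴` of a four-dimensional manifold. -/
abbrev R4 : Type := EuclideanSpace ℝ (Fin 4)

section FinslerSpacetime

variable {M : Type*} [TopologicalSpace M] [ChartedSpace R4 M]

/-- The slit tangent bundle `TM ∖ 0`. -/
def slitTangent (M : Type*) [TopologicalSpace M] [ChartedSpace R4 M] :
    Set (TangentBundle (𝓡 4) M) :=
  {v | v.2 ≠ 0}

/-- The fundamental tensor
`g_v(u, w) = (1/2) ∂²/∂s∂t L(v + t u + s w)` at `t = s = 0`, for `v, u, w ∈ T_pM`. -/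
def fundTensor (L : TangentBundle (𝓡 4) M → ℝ) {p : M} (v u w : TangentSpace (𝓡 4) p) : ℝ :=
  (1 / 2) * deriv (fun s : ℝ => deriv (fun t : ℝ => L ⟨p, v + t • u + s • w⟩) 0) 0

/-- `g_v` has signature `(+,-,-,-)`: there is a basis of `T_pM` in which its Gram matrix is
`diag(1,-1,-1,-1)`. -/
def HasSignaturePMMM (L : TangentBundle (𝓡 4) M → ℝ) {p : M} (v : TangentSpace (𝓡 4) p) : Prop :=
  ∃ b : Module.Basis (Fin 4) ℝ (TangentSpace (𝓡 4) p), ∀ i j : Fin 4,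
    fundTensor L v (b i) (b j) = Matrix.diagonal ![(1 : ℝ), -1, -1, -1] i j

variable [IsManifold (𝓡 4) ∞ M]

/-- The closure `Ā` of `A` in the slit tangent bundle. -/
def slitClosure (A : Set (TangentBundle (𝓡 4) M)) : Set (TangentBundle (𝓡 4) M) :=
  closure A ∩ slitTangent M

/-- `A` has smooth boundary in `TM ∖ 0`: near each boundary point, `A` is the positivity set of a
smooth function with nonvanishing differential at that point. -/
def HasSmoothBoundary (A : Set (TangentBundle (𝓡 4) M)) : Prop :=
  ∀ v ∈ frontier A ∩ slitTangent M, ∃ W : Set (TangentBundle (𝓡 4) M), IsOpen W ∧ v ∈ W ∧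
    ∃ ρ : TangentBundle (𝓡 4) M → ℝ, ContMDiffOn (𝓡 4).tangent 𝓘(ℝ, ℝ) ∞ ρ W ∧
      mfderiv (𝓡 4).tangent 𝓘(ℝ, ℝ) ρ v ≠ 0 ∧ A ∩ W = {w ∈ W | 0 < ρ w}

/-- `(M, L)` is a Finsler spacetime with cone domain `A`, in the convention that `L > 0` on `A` and
the signature is `(+,-,-,-)`.

The metric is a function on `Ā`; it is represented by a function `L` on `TM` whose values away from
`Ā` are irrelevant, except that, as usual for smooth functions on a domain with smooth boundary, `L`
is smooth on some open neighbourhood of `Ā`. Every `v ∈ Ā` is a limit of points of the open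
set `A`, so the fundamental tensor at `v` does not depend on the values of `L` off `Ā`. -/
structure IsFinslerSpacetime (A : Set (TangentBundle (𝓡 4) M))
    (L : TangentBundle (𝓡 4) M → ℝ) : Prop where
  subset_slit : A ⊆ slitTangent M
  isOpen : IsOpen A
  isConnected : IsConnected A
  conic : ∀ (p : M) (v : TangentSpace (𝓡 4) p) (c : ℝ), 0 < c →
    (⟨p, v⟩ : TangentBundle (𝓡 4) M) ∈ A → (⟨p, c • v⟩ : TangentBundle (𝓡 4) M) ∈ A
  fiber_nonempty : ∀ p : M, ∃ v : TangentSpace (𝓡 4) p, (⟨p, v⟩ : TangentBundle (𝓡 4) M) ∈ A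
  smooth_boundary : HasSmoothBoundary A
  smooth : ∃ O : Set (TangentBundle (𝓡 4) M), IsOpen O ∧ slitClosure A ⊆ O ∧
    ContMDiffOn (𝓡 4).tangent 𝓘(ℝ, ℝ) ∞ L O
  nonneg : ∀ v ∈ slitClosure A, 0 ≤ L v
  homogeneous : ∀ (p : M) (v : TangentSpace (𝓡 4) p) (c : ℝ), 0 < c →
    (⟨p, v⟩ : TangentBundle (𝓡 4) M) ∈ slitClosure A → L ⟨p, c • v⟩ = c ^ 2 * L ⟨p, v⟩
  signature : ∀ (p : M) (v : TangentSpace (𝓡 4) p),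
    (⟨p, v⟩ : TangentBundle (𝓡 4) M) ∈ slitClosure A → HasSignaturePMMM L v
  lightcone : frontier (slitClosure A) ∩ slitTangent M = {v ∈ slitClosure A | L v = 0}

/-- `N` is the gradient of `f` with respect to `L` on the open set `U`: it is a smooth vector
field on `U` with values in `Ā`, and `g_N(N, X) = df(X)` for all `X`. -/
structure IsGradientOn (A : Set (TangentBundle (𝓡 4) M)) (L : TangentBundle (𝓡 4) M → ℝ)
    (f : M → ℝ) (U : Set M) (N : (p : M) → TangentSpace (𝓡 4) p) : Prop where
  smooth : ContMDiffOn (𝓡 4) (𝓡 4).tangent ∞ (fun p => (⟨p, N p⟩ : TangentBundle (𝓡 4) M)) U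
  admissible : ∀ p ∈ U, (⟨p, N p⟩ : TangentBundle (𝓡 4) M) ∈ slitClosure A
  metric_eq : ∀ p ∈ U, ∀ X : TangentSpace (𝓡 4) p,
    fundTensor L (N p) (N p) X = mfderiv (𝓡 4) 𝓘(ℝ, ℝ) f p X

/-- The vector field `N` is lightlike on `U`: nowhere vanishing, with `L(N) = 0`. -/
def IsLightlikeOn (L : TangentBundle (𝓡 4) M → ℝ) (U : Set M)
    (N : (p : M) → TangentSpace (𝓡 4) p) : Prop :=
  ∀ p ∈ U, N p ≠ 0 ∧ L ⟨p, N p⟩ = 0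

/-- The coordinate vector `∂_i` at the point `q` of the chart `φ`, i.e. `d(φ⁻¹)_{φ(q)}(e_i)`. -/
def coordVec (φ : OpenPartialHomeomorph M R4) (i : Fin 4) (q : M) : TangentSpace (𝓡 4) q :=
  mfderiv (𝓡 4) (𝓡 4) φ.symm (φ q) (EuclideanSpace.single i (1 : ℝ))

/-- The matrix `g_{ij}(N) = g_N(∂_i, ∂_j)` of `g_N` at `q` in the chart `φ`. -/
def metricMatrix (L : TangentBundle (𝓡 4) M → ℝ) (N : (p : M) → TangentSpace (𝓡 4) p)
    (φ : OpenPartialHomeomorph M R4) (q : M) : Matrix (Fin 4) (Fin 4) ℝ :=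
  Matrix.of fun i j => fundTensor L (N q) (coordVec φ i q) (coordVec φ j q)

/-- The lower right block `h_{ij}`, `i, j ∈ {2, 3}`. -/
def transverseBlock (G : Matrix (Fin 4) (Fin 4) ℝ) : Matrix (Fin 2) (Fin 2) ℝ :=
  !![G 2 2, G 2 3; G 3 2, G 3 3]

/-- `φ` is a smooth chart of `M` around `p`, inside `U`, in which `N = ∂_0` and the matrix of `g_N`
has first row and first column `(0, 1, 0, 0)` throughout. -/
structure IsLightlikeChart (L : TangentBundle (𝓡 4) M → ℝ) (U : Set M)
    (N : (p : M) → TangentSpace (𝓡 4) p) (p : M) (φ : OpenPartialHomeomorph M R4) : Prop where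
  mem_atlas : φ ∈ IsManifold.maximalAtlas (𝓡 4) ∞ M
  mem_source : p ∈ φ.source
  source_subset : φ.source ⊆ U
  field_eq : ∀ q ∈ φ.source, N q = coordVec φ 0 q
  matrix_eq : ∀ q ∈ φ.source,
    let G := metricMatrix L N φ q
    G = !![0, 1, 0, 0;
           1, G 1 1, G 1 2, G 1 3;
           0, G 2 1, G 2 2, G 2 3;
           0, G 3 1, G 3 2, G 3 3]

end FinslerSpacetime

end

open scoped Topology Matrix
open Set Filter Metric

section InverseFunction

variable {E F : Type*} [NormedAddCommGroup E] [NormedSpace ℝ E] [CompleteSpace E]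
  [NormedAddCommGroup F] [NormedSpace ℝ F]

/-- Inverse function theorem, with smoothness of the map and of its inverse at every point of
the source and of the target. -/
theorem exists_smooth_localHomeomorph {f : E → F} {a : E}
    (hf : ∀ᶠ x in 𝓝 a, ContDiffAt ℝ ∞ f x) {f' : E ≃L[ℝ] F}
    (hf' : HasFDerivAt f (f' : E →L[ℝ] F) a) {s : Set E} (hs : s ∈ 𝓝 a) :
    ∃ e : OpenPartialHomeomorph E F, a ∈ e.source ∧ (∀ x, e x = f x) ∧ e.source ⊆ s ∧
      (∀ x ∈ e.source, ContDiffAt ℝ ∞ f x) ∧ ∀ y ∈ e.target, ContDiffAt ℝ ∞ e.symm y := by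
  have hfa : ContDiffAt ℝ ∞ f a := hf.self_of_nhds
  have hn : (∞ : WithTop ℕ∞) ≠ 0 := by simp
  have hcont : ContinuousAt (fderiv ℝ f) a := (hfa.fderiv_right (m := 0) (by simp)).continuousAt
  have hinv : ∀ᶠ x in 𝓝 a, fderiv ℝ f x ∈ range ((↑) : (E ≃L[ℝ] F) → E →L[ℝ] F) := by
    apply hcont
    rw [hf'.fderiv]
    exact ContinuousLinearEquiv.nhds f'
  obtain ⟨W, hW, hWo, haW⟩ := _root_.mem_nhds_iff.1 (inter_mem (inter_mem hf hinv) hs)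
  let e₀ := hfa.toOpenPartialHomeomorph f hf' hn
  refine ⟨e₀.restrOpen W hWo, ⟨hfa.mem_toOpenPartialHomeomorph_source hf' hn, haW⟩,
    fun x => rfl, fun x hx => (hW hx.2).2, fun x hx => (hW hx.2).1.1, fun y hy => ?_⟩
  set e := e₀.restrOpen W hWo with he
  have hxs : e.symm y ∈ e.source := e.map_target hy
  obtain ⟨g, hg⟩ := (hW hxs.2).1.2
  have hc : ContDiffAt ℝ ∞ f (e.symm y) := (hW hxs.2).1.1
  refine e.contDiffAt_symm (f₀' := g) hy ?_ hc
  rw [hg]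
  exact (hc.differentiableAt hn).hasFDerivAt

end InverseFunction

section Superposition

universe u

variable {X : Type*} [TopologicalSpace X] [CompactSpace X]

/-- Pointwise application of a continuous family of linear maps to a continuous map. -/
noncomputable def pointwiseApply (X : Type*) [TopologicalSpace X] [CompactSpace X]
    (E F : Type*) [NormedAddCommGroup E] [NormedSpace ℝ E] [NormedAddCommGroup F]
    [NormedSpace ℝ F] : C(X, E →L[ℝ] F) →L[ℝ] C(X, E) →L[ℝ] C(X, F) :=
  LinearMap.mkContinuous₂
    (LinearMap.mk₂ ℝ (fun (A : C(X, E →L[ℝ] F)) (y : C(X, E)) =>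
        (⟨fun t => A t (y t), by fun_prop⟩ : C(X, F)))
      (fun _ _ _ => by ext; simp) (fun _ _ _ => by ext; simp)
      (fun _ _ _ => by ext; simp) (fun _ _ _ => by ext; simp)) 1
    (fun A y => by
      rw [ContinuousMap.norm_le _ (by positivity)]
      intro t
      rw [one_mul]
      exact (A t).le_of_opNorm_le_of_le (A.norm_coe_le_norm t) (y.norm_coe_le_norm t))

@[simp]
theorem pointwiseApply_apply {E F : Type*} [NormedAddCommGroup E] [NormedSpace ℝ E]
    [NormedAddCommGroup F] [NormedSpace ℝ F] (A : C(X, E →L[ℝ] F)) (y : C(X, E)) (t : X) :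
    pointwiseApply X E F A y t = A t (y t) := rfl

theorem hasFDerivAt_postcomp {E F : Type*} [NormedAddCommGroup E] [NormedSpace ℝ E]
    [NormedAddCommGroup F] [NormedSpace ℝ F] (v : C(E, F)) (v' : C(E, E →L[ℝ] F))
    (hv : ∀ x, HasFDerivAt v (v' x) x) (y : C(X, E)) :
    HasFDerivAt (fun z : C(X, E) => v.comp z) (pointwiseApply X E F (v'.comp y)) y := by
  rw [hasFDerivAt_iff_isLittleO, Asymptotics.isLittleO_iff]
  intro c hc
  have hcont := (ContinuousMap.continuous_postcomp (X := X) v').continuousAt (x := y)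
  obtain ⟨δ, hδ, hball⟩ := (Metric.continuousAt_iff (α := C(X, E))
    (β := C(X, E →L[ℝ] F))).1 hcont c hc
  filter_upwards [Metric.ball_mem_nhds y hδ] with z hz
  rw [ContinuousMap.norm_le _ (by positivity)]
  intro t
  have hseg : ∀ w ∈ segment ℝ (y t) (z t), ‖v' w - v' (y t)‖ ≤ c := by
    rintro w ⟨a, b, ha, hb, hab, rfl⟩
    have hmem : a • y + b • z ∈ Metric.ball y δ :=
      (convex_ball y δ) (Metric.mem_ball_self hδ) hz ha hb hab
    have h1 := (hball hmem).le
    rw [← dist_eq_norm]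
    exact (ContinuousMap.dist_apply_le_dist (f := v'.comp (a • y + b • z))
      (g := v'.comp y) t).trans h1
  have h2 := (convex_segment (y t) (z t)).norm_image_sub_le_of_norm_hasFDerivWithin_le'
    (fun w _ => (hv w).hasFDerivWithinAt) hseg (left_mem_segment ℝ _ _) (right_mem_segment ℝ _ _)
  calc _ = ‖v (z t) - v (y t) - v' (y t) (z t - y t)‖ := by simp
    _ ≤ c * ‖z t - y t‖ := h2
    _ ≤ c * ‖z - y‖ := by
      gcongr
      exact ContinuousMap.norm_coe_le_norm (z - y) t

theorem contDiff_postcomp_nat {E : Type u} [NormedAddCommGroup E] [NormedSpace ℝ E] (n : ℕ) :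
    ∀ {F : Type u} [NormedAddCommGroup F] [NormedSpace ℝ F] (v : C(E, F)), ContDiff ℝ n v →
      ContDiff ℝ n (fun z : C(X, E) => v.comp z) := by
  induction n with
  | zero =>
    intro F _ _ v _
    exact contDiff_zero.2 (ContinuousMap.continuous_postcomp v)
  | succ n ih =>
    intro F _ _ v hv
    obtain ⟨f', hf', hv'⟩ := contDiff_succ_iff_hasFDerivAt.1 hv
    let w : C(E, E →L[ℝ] F) := ⟨f', hf'.continuous⟩
    refine contDiff_succ_iff_hasFDerivAt.2 ⟨fun y => pointwiseApply X E F (w.comp y), ?_,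
      fun y => hasFDerivAt_postcomp v w hv' y⟩
    exact (pointwiseApply X E F).contDiff.comp (ih w hf')

/-- Composition with a smooth map is a smooth operator on continuous maps. -/
theorem contDiff_postcomp {E F : Type u} [NormedAddCommGroup E] [NormedSpace ℝ E]
    [NormedAddCommGroup F] [NormedSpace ℝ F] (v : C(E, F)) (hv : ContDiff ℝ ∞ v) :
    ContDiff ℝ ∞ (fun z : C(X, E) => v.comp z) :=
  contDiff_infty.2 fun n => contDiff_postcomp_nat n v (contDiff_infty.1 hv n)

end Superposition

section Primitive

variable {E : Type*} [NormedAddCommGroup E] [NormedSpace ℝ E]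

theorem continuous_primitive_IccExtend (y : C(Icc (0 : ℝ) 1, E)) :
    Continuous fun s : Icc (0 : ℝ) 1 => ∫ r in (0 : ℝ)..s, IccExtend zero_le_one y r :=
  (intervalIntegral.continuous_primitive
    (fun _ _ => (y.continuous.Icc_extend' (h := zero_le_one)).intervalIntegrable _ _) 0).comp
    continuous_subtype_val

/-- The primitive of a continuous curve on the unit interval that vanishes at `0`. -/
noncomputable def primitiveCLM (E : Type*) [NormedAddCommGroup E] [NormedSpace ℝ E] :
    C(Icc (0 : ℝ) 1, E) →L[ℝ] C(Icc (0 : ℝ) 1, E) :=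
  LinearMap.mkContinuous
    { toFun := fun y => ⟨_, continuous_primitive_IccExtend y⟩
      map_add' := fun y z => by
        ext s
        exact intervalIntegral.integral_add
          ((y.continuous.Icc_extend' (h := zero_le_one)).intervalIntegrable _ _)
          ((z.continuous.Icc_extend' (h := zero_le_one)).intervalIntegrable _ _)
      map_smul' := fun c y => by
        ext s
        exact intervalIntegral.integral_smul c _ } 1
    (fun y => by
      rw [ContinuousMap.norm_le _ (by positivity)]
      intro s
      have h := intervalIntegral.norm_integral_le_of_norm_le_const (a := 0) (b := (s : ℝ))
        (f := IccExtend zero_le_one y) (C := ‖y‖) (fun r _ => y.norm_coe_le_norm _)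
      refine h.trans ?_
      rw [sub_zero, abs_of_nonneg s.2.1, mul_comm]
      gcongr
      exact s.2.2)

theorem primitiveCLM_apply (y : C(Icc (0 : ℝ) 1, E)) (s : Icc (0 : ℝ) 1) :
    primitiveCLM E y s = ∫ r in (0 : ℝ)..s, IccExtend zero_le_one y r := rfl

/-- Multiplication by `s` as a self-map of the unit interval. -/
def unitScale (s : Icc (0 : ℝ) 1) : C(Icc (0 : ℝ) 1, Icc (0 : ℝ) 1) :=
  ⟨fun r => ⟨s * r, mul_nonneg s.2.1 r.2.1, mul_le_one₀ s.2.2 r.2.1 r.2.2⟩, by fun_prop⟩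

theorem primitiveCLM_unitScale (y : C(Icc (0 : ℝ) 1, E)) (s u : Icc (0 : ℝ) 1) :
    primitiveCLM E y (unitScale s u) = (s : ℝ) • primitiveCLM E (y.comp (unitScale s)) u := by
  have h := intervalIntegral.smul_integral_comp_mul_left (a := 0) (b := (u : ℝ))
    (IccExtend zero_le_one y) (s : ℝ)
  rw [mul_zero] at h
  rw [primitiveCLM_apply, primitiveCLM_apply]
  change _ = (s : ℝ) • ∫ r in (0 : ℝ)..u, _
  refine h.symm.trans ?_
  congr 1
  refine intervalIntegral.integral_congr fun r hr => ?_
  rw [uIcc_of_le u.2.1] at hr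
  have hr1 : r ∈ Icc (0 : ℝ) 1 := ⟨hr.1, hr.2.trans u.2.2⟩
  have hr2 : (s : ℝ) * r ∈ Icc (0 : ℝ) 1 :=
    ⟨mul_nonneg s.2.1 hr1.1, mul_le_one₀ s.2.2 hr1.1 hr1.2⟩
  simp only [IccExtend_of_mem zero_le_one _ hr1, IccExtend_of_mem zero_le_one _ hr2]
  rfl

end Primitive

section Flow

variable {E : Type*} [NormedAddCommGroup E] [NormedSpace ℝ E]

/-- The defect of a curve `y` as a solution of `y(s) = x + t ∫₀ˢ v(y)`, where `z = (t, x)`;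
it is paired with `z`. -/
noncomputable def flowDefect (v : C(E, E)) (q : (ℝ × E) × C(Icc (0 : ℝ) 1, E)) :
    (ℝ × E) × C(Icc (0 : ℝ) 1, E) :=
  (q.1, q.2 - (ContinuousMap.const _ q.1.2 + q.1.1 • primitiveCLM E (v.comp q.2)))

/-- The inclusion of constant curves. -/
noncomputable def constCurve (E : Type*) [NormedAddCommGroup E] [NormedSpace ℝ E] :
    E →L[ℝ] C(Icc (0 : ℝ) 1, E) :=
  ContinuousLinearMap.const ℝ _

theorem contDiff_flowDefect (v : C(E, E)) (hv : ContDiff ℝ ∞ v) :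
    ContDiff ℝ ∞ (flowDefect v) := by
  have h1 : ContDiff ℝ ∞ fun q : (ℝ × E) × C(Icc (0 : ℝ) 1, E) => constCurve E q.1.2 := by
    fun_prop
  have h2 : ContDiff ℝ ∞ fun q : (ℝ × E) × C(Icc (0 : ℝ) 1, E) =>
      primitiveCLM E (v.comp q.2) :=
    (primitiveCLM E).contDiff.comp ((contDiff_postcomp v hv).comp contDiff_snd)
  have h3 : ContDiff ℝ ∞ fun q : (ℝ × E) × C(Icc (0 : ℝ) 1, E) => q.1.1 := by fun_prop
  exact contDiff_fst.prodMk (contDiff_snd.sub (h1.add (h3.smul h2)))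

theorem hasFDerivAt_flowDefect (v : C(E, E)) (hv : ContDiff ℝ ∞ v) (x₀ : E) :
    HasFDerivAt (flowDefect v)
      (((ContinuousLinearEquiv.refl ℝ (ℝ × E)).skewProd
        (ContinuousLinearEquiv.refl ℝ C(Icc (0 : ℝ) 1, E))
        (-(constCurve E ∘L .snd ℝ ℝ E + (ContinuousLinearMap.fst ℝ ℝ E).smulRight
          (primitiveCLM E (v.comp (ContinuousMap.const _ x₀)))) :
          ℝ × E →L[ℝ] C(Icc (0 : ℝ) 1, E))
        : ((ℝ × E) × C(Icc (0 : ℝ) 1, E)) ≃L[ℝ] (ℝ × E) × C(Icc (0 : ℝ) 1, E)) :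
        ((ℝ × E) × C(Icc (0 : ℝ) 1, E)) →L[ℝ] (ℝ × E) × C(Icc (0 : ℝ) 1, E))
      ((0, x₀), ContinuousMap.const _ x₀) := by
  set u : (ℝ × E) × C(Icc (0 : ℝ) 1, E) := ((0, x₀), ContinuousMap.const _ x₀)
  have h1 : HasFDerivAt (fun q : (ℝ × E) × C(Icc (0 : ℝ) 1, E) => constCurve E q.1.2)
      (constCurve E ∘L .snd ℝ ℝ E ∘L .fst ℝ _ _) u :=
    (constCurve E).hasFDerivAt.comp u (hasFDerivAt_snd.comp u hasFDerivAt_fst)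
  have h2 : DifferentiableAt ℝ (fun q : (ℝ × E) × C(Icc (0 : ℝ) 1, E) =>
      primitiveCLM E (v.comp q.2)) u :=
    (((primitiveCLM E).contDiff.comp
      ((contDiff_postcomp v hv).comp contDiff_snd)).differentiable (by simp)) u
  have h3 : HasFDerivAt (fun q : (ℝ × E) × C(Icc (0 : ℝ) 1, E) => q.1.1)
      (.fst ℝ ℝ E ∘L .fst ℝ _ _) u :=
    hasFDerivAt_fst.comp u hasFDerivAt_fst
  refine (hasFDerivAt_fst.prodMk
    (hasFDerivAt_snd.sub (h1.add (h3.smul h2.hasFDerivAt)))).congr_fderiv ?_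
  ext q <;> simp [u, sub_eq_add_neg]

/-- Smooth local flows. The last clause says that `Φ` is a flow of `v`. -/
theorem exists_smooth_flow [CompleteSpace E] {v : E → E} (hv : ContDiff ℝ ∞ v) (x₀ : E) :
    ∃ Φ : ℝ × E → E, (∀ᶠ z in 𝓝 ((0 : ℝ), x₀), ContDiffAt ℝ ∞ Φ z) ∧
      (∀ᶠ x in 𝓝 x₀, Φ (0, x) = x) ∧
      ∀ᶠ z in 𝓝 ((0 : ℝ), x₀), HasDerivAt (fun t => Φ (t, z.2)) (v (Φ z)) z.1 := by
  let V : C(E, E) := ⟨v, hv.continuous⟩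
  set u : (ℝ × E) × C(Icc (0 : ℝ) 1, E) := ((0, x₀), ContinuousMap.const _ x₀) with hu
  have hVs := contDiff_flowDefect V hv
  obtain ⟨e, hue, heF, -, -, hsymm⟩ := exists_smooth_localHomeomorph
    (Eventually.of_forall fun q => hVs.contDiffAt) (hasFDerivAt_flowDefect V hv x₀) univ_mem
  have hu0 : e u = ((0, x₀), 0) := by
    rw [heF]; simp [flowDefect, hu]
  let Y : ℝ × E → C(Icc (0 : ℝ) 1, E) := fun z => (e.symm (z, 0)).2
  have hYu : Y (0, x₀) = ContinuousMap.const _ x₀ := by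
    simp only [Y]; rw [← hu0, e.left_inv hue]
  have hι : Continuous fun z : ℝ × E => (z, (0 : C(Icc (0 : ℝ) 1, E))) := by fun_prop
  have htgt : ∀ᶠ z in 𝓝 ((0 : ℝ), x₀), (z, (0 : C(Icc (0 : ℝ) 1, E))) ∈ e.target := by
    refine hι.continuousAt.eventually (e.open_target.mem_nhds ?_)
    have h := e.map_source hue
    rwa [← hu, hu0] at h
  have hYsmooth : ∀ᶠ z in 𝓝 ((0 : ℝ), x₀), ContDiffAt ℝ ∞ Y z := by
    filter_upwards [htgt] with z hz
    have h1 : ContDiffAt ℝ ∞ (fun z : ℝ × E => (z, (0 : C(Icc (0 : ℝ) 1, E)))) z := by fun_prop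
    exact contDiffAt_snd.comp z ((hsymm _ hz).comp z h1)
  have hYeq : ∀ᶠ z in 𝓝 ((0 : ℝ), x₀),
      Y z = ContinuousMap.const _ z.2 + z.1 • primitiveCLM E (V.comp (Y z)) := by
    filter_upwards [htgt] with z hz
    have h1 : flowDefect V (e.symm (z, 0)) = (z, 0) := by rw [← heF, e.right_inv hz]
    have h2 : (e.symm (z, 0)).1 = z := congrArg Prod.fst h1
    have h3 := congrArg Prod.snd h1
    simp only [flowDefect, h2] at h3
    exact sub_eq_zero.1 h3
  obtain ⟨r, hr, hball⟩ := Metric.isOpen_iff.1 e.open_source u hue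
  have hYnear : ∀ᶠ z in 𝓝 ((0 : ℝ), x₀), dist (Y z) (ContinuousMap.const _ x₀) < r := by
    have := hYsmooth.self_of_nhds.continuousAt
    rw [ContinuousAt, hYu] at this
    exact this.eventually (Metric.ball_mem_nhds _ hr)
  obtain ⟨ρ, hρ, hgood⟩ := Metric.eventually_nhds_iff_ball.1
    ((hYsmooth.and hYeq).and (hYnear.and (Metric.ball_mem_nhds ((0 : ℝ), x₀) hr)))
  have hresc : ∀ z ∈ ball ((0 : ℝ), x₀) ρ, ∀ s : Icc (0 : ℝ) 1,
      Y (s * z.1, z.2) 1 = Y z s := by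
    intro z hz s
    obtain ⟨⟨-, h1⟩, h2, h3⟩ := hgood z hz
    have hmem : ((((s : ℝ) * z.1, z.2), (Y z).comp (unitScale s)) :
        (ℝ × E) × C(Icc (0 : ℝ) 1, E)) ∈ e.source := by
      apply hball
      rw [Prod.dist_eq] at h3
      rw [mem_ball, Prod.dist_eq, Prod.dist_eq]
      simp only [hu, max_lt_iff] at h3 ⊢
      refine ⟨⟨?_, h3.2⟩, ?_⟩
      · refine lt_of_le_of_lt ?_ h3.1
        rw [dist_zero_right, dist_zero_right, norm_mul, Real.norm_of_nonneg s.2.1]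
        exact mul_le_of_le_one_left (norm_nonneg _) s.2.2
      · refine (ContinuousMap.dist_lt_iff hr).2 fun a => ?_
        exact (ContinuousMap.dist_apply_le_dist (f := Y z)
          (g := ContinuousMap.const _ x₀) (unitScale s a)).trans_lt h2
    have hval : flowDefect V ((((s : ℝ) * z.1, z.2), (Y z).comp (unitScale s)) :
        (ℝ × E) × C(Icc (0 : ℝ) 1, E)) = (((s : ℝ) * z.1, z.2), 0) := by
      refine Prod.ext rfl ?_
      refine sub_eq_zero.2 ?_
      ext a
      have h4 := congrArg (fun w : C(Icc (0 : ℝ) 1, E) => w (unitScale s a)) h1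
      simp only [ContinuousMap.add_apply, ContinuousMap.smul_apply,
        primitiveCLM_unitScale] at h4
      simp only [ContinuousMap.comp_apply, ContinuousMap.add_apply, ContinuousMap.smul_apply]
      rw [h4, mul_comm, mul_smul]
      rfl
    have h5 : e.symm (((s : ℝ) * z.1, z.2), 0) =
        (((s : ℝ) * z.1, z.2), (Y z).comp (unitScale s)) := by
      rw [← hval, ← heF, e.left_inv hmem]
    have h6 : Y (s * z.1, z.2) = (Y z).comp (unitScale s) := congrArg Prod.snd h5
    rw [h6]
    change Y z (unitScale s 1) = Y z s
    congr 1
    ext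
    exact mul_one _
  have hΦs : ∀ z, ContDiffAt ℝ ∞ Y z → ContDiffAt ℝ ∞ (fun z => Y z 1) z := fun z hz =>
    (ContinuousMap.evalCLM ℝ 1 : C(Icc (0 : ℝ) 1, E) →L[ℝ] E).contDiff.contDiffAt.comp z hz
  refine ⟨fun z => Y z 1, hYsmooth.mono hΦs, ?_, ?_⟩
  · have hc : ContinuousAt (fun x : E => ((0 : ℝ), x)) x₀ := by fun_prop
    filter_upwards [hc.eventually hYeq] with x hx
    rw [hx]; simp
  · filter_upwards [Metric.ball_mem_nhds ((0 : ℝ), x₀) (half_pos hρ)] with z hz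
    have hz' : |z.1| < ρ / 2 ∧ dist z.2 x₀ < ρ / 2 := by
      rw [mem_ball, Prod.dist_eq, max_lt_iff, Real.dist_eq] at hz
      simpa using hz
    obtain ⟨t₁, ht₁, ht₁ρ, s, hs⟩ : ∃ t₁ : ℝ, t₁ ≠ 0 ∧ |t₁| < ρ ∧
        ∃ s : Icc (0 : ℝ) 1, (s : ℝ) * t₁ = z.1 := by
      rcases le_total 0 z.1 with h | h
      · rw [abs_of_nonneg h] at hz'
        refine ⟨ρ / 2, by positivity, by rw [abs_of_pos (by positivity)]; linarith,
          ⟨z.1 / (ρ / 2), by positivity, (div_le_one (by positivity)).2 hz'.1.le⟩, ?_⟩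
        field_simp
      · rw [abs_of_nonpos h] at hz'
        refine ⟨-(ρ / 2), by simp [hρ.ne'], by
          rw [abs_neg, abs_of_pos (by positivity)]; linarith,
          ⟨-z.1 / (ρ / 2), div_nonneg (by linarith) (by positivity),
            (div_le_one (by positivity)).2 hz'.1.le⟩, ?_⟩
        field_simp
    have hz₁ : ((t₁, z.2) : ℝ × E) ∈ ball ((0 : ℝ), x₀) ρ := by
      rw [mem_ball, Prod.dist_eq, max_lt_iff]
      exact ⟨by simpa [Real.dist_eq] using ht₁ρ, by simpa using hz'.2.trans (half_lt_self hρ)⟩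
    have hzρ : z ∈ ball ((0 : ℝ), x₀) ρ := ball_subset_ball (half_lt_self hρ).le hz
    have hΦd : DifferentiableAt ℝ (fun z => Y z 1) z :=
      (hΦs z (hgood z hzρ).1.1).differentiableAt (by simp)
    have hpath : HasDerivAt (fun t : ℝ => ((t, z.2) : ℝ × E)) (1, 0) z.1 :=
      (hasDerivAt_id _).prodMk (hasDerivAt_const _ _)
    have hd : HasDerivAt (fun t => Y (t, z.2) 1) (fderiv ℝ (fun z => Y z 1) z (1, 0)) z.1 :=
      HasFDerivAt.comp_hasDerivAt (x := z.1) (f := fun t : ℝ => ((t, z.2) : ℝ × E))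
        (l := fun z => Y z 1) hΦd.hasFDerivAt hpath
    set w := fderiv ℝ (fun z => Y z 1) z (1, 0)
    suffices hw : w = v (Y z 1) by rw [← hw]; exact hd
    have hYz : Y z 1 = Y (t₁, z.2) s := by
      rw [← hresc _ hz₁ s, hs]
    have hA : HasDerivWithinAt (fun a : ℝ => Y (a * t₁, z.2) 1) (t₁ • w) (Icc 0 1) s := by
      rw [← hs] at hd
      exact (HasDerivAt.scomp (s : ℝ) hd (hasDerivAt_mul_const t₁)).hasDerivWithinAt
    have hB : HasDerivWithinAt (fun a : ℝ => Y (a * t₁, z.2) 1)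
        (t₁ • v (Y (t₁, z.2) s)) (Icc 0 1) s := by
      have hcont : Continuous (IccExtend zero_le_one (V.comp (Y (t₁, z.2)))) :=
        (V.comp (Y (t₁, z.2))).continuous.Icc_extend'
      have h1 := (hcont.integral_hasStrictDerivAt 0 (s : ℝ)).hasDerivAt
      have h2 := ((h1.const_smul t₁).const_add z.2).hasDerivWithinAt (s := Icc (0 : ℝ) 1)
      rw [IccExtend_val] at h2
      refine h2.congr_of_mem (fun a ha => ?_) s.2
      rw [hresc _ hz₁ ⟨a, ha⟩]
      exact congrArg (fun w : C(Icc (0 : ℝ) 1, E) => w ⟨a, ha⟩) (hgood _ hz₁).1.2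
    have h := (uniqueDiffOn_Icc_zero_one _ s.2).eq_deriv _ hA hB
    rw [hYz]
    exact smul_right_injective E ht₁ h

end Flow

section FlowBox

/-- A map that is smooth near a point agrees near that point with a smooth map. -/
theorem exists_contDiff_eventuallyEq {E F : Type*} [NormedAddCommGroup E] [NormedSpace ℝ E]
    [FiniteDimensional ℝ E] [NormedAddCommGroup F] [NormedSpace ℝ F] {v : E → F} {x₀ : E}
    (hv : ∀ᶠ x in 𝓝 x₀, ContDiffAt ℝ ∞ v x) :
    ∃ w : E → F, ContDiff ℝ ∞ w ∧ w =ᶠ[𝓝 x₀] v := by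
  obtain ⟨r, hr, hball⟩ := Metric.eventually_nhds_iff_ball.1 hv
  let χ : ContDiffBump x₀ := ⟨r / 4, r / 2, by positivity, by linarith⟩
  refine ⟨fun x => χ x • v x, ?_, ?_⟩
  · rw [contDiff_iff_contDiffAt]
    intro x
    by_cases hx : x ∈ ball x₀ r
    · exact χ.contDiff.contDiffAt.smul (hball x hx)
    · have hx' : x ∉ closedBall x₀ (r / 2) := fun h =>
        hx (closedBall_subset_ball (half_lt_self hr) h)
      refine (contDiffAt_const (c := (0 : F))).congr_of_eventuallyEq ?_
      filter_upwards [isClosed_closedBall.isOpen_compl.mem_nhds hx'] with y hy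
      have : χ y = 0 := χ.zero_of_le_dist (not_le.1 fun h => hy h).le
      simp [this]
  · filter_upwards [χ.eventuallyEq_one] with x hx
    simp [hx]

/-- A nonzero vector in the kernel of a nonzero linear form is the first vector of a basis in which
the form is the second coordinate. -/
theorem exists_equiv_of_mem_ker {v : R4} {α : R4 →L[ℝ] ℝ} (hv : v ≠ 0) (hα : α ≠ 0)
    (hαv : α v = 0) :
    ∃ T : R4 ≃L[ℝ] R4, T (EuclideanSpace.single 0 1) = v ∧ ∀ y, α (T y) = y 1 := by
  set a : R4 := (InnerProductSpace.toDual ℝ R4).symm α with ha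
  have hαa : ∀ x, α x = inner ℝ a x := fun x => by
    rw [ha, InnerProductSpace.toDual_symm_apply]
  have ha0 : a ≠ 0 := by
    rw [ha]; simpa using hα
  have hv' : ‖v‖ ≠ 0 := norm_ne_zero_iff.2 hv
  have ha' : ‖a‖ ≠ 0 := norm_ne_zero_iff.2 ha0
  have hav : inner ℝ a v = 0 := by rw [← hαa, hαv]
  let w : Fin 4 → R4 := ![‖v‖⁻¹ • v, ‖a‖⁻¹ • a, 0, 0]
  have hw : Orthonormal ℝ (({0, 1} : Set (Fin 4)).domRestrict w) := by
    have h0 : ‖w 0‖ = 1 := norm_smul_inv_norm (𝕜 := ℝ) hv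
    have h1 : ‖w 1‖ = 1 := norm_smul_inv_norm (𝕜 := ℝ) ha0
    have h10 : inner ℝ (w 1) (w 0) = 0 := by
      change inner ℝ (‖a‖⁻¹ • a) (‖v‖⁻¹ • v) = 0
      rw [inner_smul_left, inner_smul_right, hav, mul_zero, mul_zero]
    have h01 : inner ℝ (w 0) (w 1) = 0 := by rw [real_inner_comm, h10]
    constructor
    · rintro ⟨i, rfl | rfl⟩
      exacts [h0, h1]
    · rintro ⟨i, rfl | rfl⟩ ⟨j, rfl | rfl⟩ hij
      exacts [absurd rfl hij, h01, h10, absurd rfl hij]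
  obtain ⟨b, hb⟩ := hw.exists_orthonormalBasis_extension_of_card_eq (by simp)
  have hb0 : b 0 = ‖v‖⁻¹ • v := hb 0 (by simp)
  have hb1 : b 1 = ‖a‖⁻¹ • a := hb 1 (by simp)
  let c : Fin 4 → ℝ := ![‖v‖, ‖a‖⁻¹, 1, 1]
  have hc : ∀ i, IsUnit (c i) := by
    intro i
    fin_cases i <;> simp [c, hv, ha0]
  let B := b.toBasis.isUnitSMul hc
  let T := ((EuclideanSpace.basisFun (Fin 4) ℝ).toBasis.equiv B (Equiv.refl _))
  have hT : ∀ i, T (EuclideanSpace.single i 1) = c i • b i := by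
    intro i
    have h := (EuclideanSpace.basisFun (Fin 4) ℝ).toBasis.equiv_apply i B (Equiv.refl _)
    simpa [B, T, Module.Basis.isUnitSMul_apply] using h
  have haa : a = ‖a‖ • b 1 := by rw [hb1, smul_smul, mul_inv_cancel₀ ha', one_smul]
  have hαT : ∀ i, α (T (EuclideanSpace.single i 1)) = if i = 1 then 1 else 0 := by
    intro i
    rw [hT, hαa, haa, inner_smul_left, inner_smul_right, b.inner_eq_ite]
    by_cases hi : i = 1
    · subst hi; simp [c, ha0]
    · simp [hi, Ne.symm hi]
  refine ⟨T.toContinuousLinearEquiv, ?_, fun y => ?_⟩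
  · change T _ = v
    rw [hT, hb0, smul_smul]
    simp [c, hv']
  · change α (T y) = y 1
    have hy : y = ∑ i, y i • EuclideanSpace.single i (1 : ℝ) := by
      ext j
      simp [Finset.sum_apply, Pi.single_apply]
    conv_lhs => rw [hy]
    simp [map_sum, hαT]

/-- Along a flow of `v`, a function annihilated by `v` is constant. -/
theorem eventually_flow_const {E : Type*} [NormedAddCommGroup E] [NormedSpace ℝ E]
    {v : E → E} {f : E → ℝ} {Φ : ℝ × E → E} {x₀ : E}
    (hf : ∀ᶠ x in 𝓝 x₀, DifferentiableAt ℝ f x) (hvf : ∀ᶠ x in 𝓝 x₀, fderiv ℝ f x (v x) = 0)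
    (hΦ : ContinuousAt Φ (0, x₀)) (hΦ0 : ∀ᶠ x in 𝓝 x₀, Φ (0, x) = x)
    (hΦv : ∀ᶠ z in 𝓝 ((0 : ℝ), x₀), HasDerivAt (fun t => Φ (t, z.2)) (v (Φ z)) z.1) :
    ∀ᶠ z in 𝓝 ((0 : ℝ), x₀), f (Φ z) = f z.2 := by
  rw [ContinuousAt, hΦ0.self_of_nhds] at hΦ
  obtain ⟨r, hr, hball⟩ := Metric.eventually_nhds_iff_ball.1
    ((hΦ.eventually (hf.and hvf)).and (hΦv.and (continuousAt_snd.eventually hΦ0)))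
  filter_upwards [Metric.ball_mem_nhds ((0 : ℝ), x₀) hr] with z hz
  rw [← ball_prod_same] at hz hball
  have hd : ∀ t ∈ ball (0 : ℝ) r, HasDerivAt (fun t => f (Φ (t, z.2))) 0 t := by
    intro t ht
    obtain ⟨⟨h1, h2⟩, h3, -⟩ := hball (t, z.2) ⟨ht, hz.2⟩
    rw [← h2]
    exact HasFDerivAt.comp_hasDerivAt (x := t) (f := fun t => Φ (t, z.2)) h1.hasFDerivAt h3
  have hconst := isOpen_ball.is_const_of_deriv_eq_zero (convex_ball (0 : ℝ) r).isPreconnected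
    (fun t ht => (hd t ht).differentiableAt.differentiableWithinAt) (fun t ht => (hd t ht).deriv)
    hz.1 (mem_ball_self hr)
  have h0 : Φ (0, z.2) = z.2 := (hball (0, z.2) ⟨mem_ball_self hr, hz.2⟩).2.2
  simpa [h0] using hconst

/-- Rectification of a vector field together with a function annihilated by it. -/
theorem exists_rectification {v : R4 → R4} {f : R4 → ℝ} {x₀ : R4}
    (hv : ∀ᶠ x in 𝓝 x₀, ContDiffAt ℝ ∞ v x) (hf : ∀ᶠ x in 𝓝 x₀, ContDiffAt ℝ ∞ f x)
    (hvf : ∀ᶠ x in 𝓝 x₀, fderiv ℝ f x (v x) = 0) (hv0 : v x₀ ≠ 0) (hf0 : fderiv ℝ f x₀ ≠ 0)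
    {s : Set R4} (hs : s ∈ 𝓝 x₀) :
    ∃ Ψ : OpenPartialHomeomorph R4 R4, x₀ ∈ Ψ.target ∧ Ψ.target ⊆ s ∧
      (∀ y ∈ Ψ.source, ContDiffAt ℝ ∞ Ψ y) ∧ (∀ x ∈ Ψ.target, ContDiffAt ℝ ∞ Ψ.symm x) ∧
      ∀ y ∈ Ψ.source, fderiv ℝ Ψ y (EuclideanSpace.single 0 1) = v (Ψ y) ∧
        ∀ i, fderiv ℝ (fun y => f (Ψ y)) y (EuclideanSpace.single i 1) =
          if i = 1 then 1 else 0 := by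
  obtain ⟨w, hw, hwv⟩ := exists_contDiff_eventuallyEq hv
  obtain ⟨Φ, hΦs, hΦ0, hΦw⟩ := exists_smooth_flow hw x₀
  obtain ⟨T, hTv, hTf⟩ := exists_equiv_of_mem_ker hv0 hf0 hvf.self_of_nhds
  have hfd : HasFDerivAt f (fderiv ℝ f x₀) x₀ :=
    (hf.self_of_nhds.differentiableAt (by simp)).hasFDerivAt
  -- coordinates in which `f` is linear
  let χ : R4 → R4 := fun x => T.symm (x - x₀) +
    (f x - f x₀ - T.symm (x - x₀) 1) • EuclideanSpace.single 1 1
  have hχ1 : ∀ x, χ x 1 = f x - f x₀ := fun x => by simp [χ]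
  have hχ0 : χ x₀ = 0 := by simp [χ]
  have hχs : ∀ᶠ x in 𝓝 x₀, ContDiffAt ℝ ∞ χ x := by
    filter_upwards [hf] with x hx
    have h1 : ContDiffAt ℝ ∞ (fun x => T.symm (x - x₀)) x :=
      T.symm.contDiff.contDiffAt.comp x (by fun_prop)
    have h2 : ContDiffAt ℝ ∞ (fun x => T.symm (x - x₀) 1) x :=
      (EuclideanSpace.proj (𝕜 := ℝ) (1 : Fin 4)).contDiff.contDiffAt.comp x h1
    exact h1.add (((hx.sub contDiffAt_const).sub h2).smul contDiffAt_const)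
  have hχd : HasFDerivAt χ (T.symm : R4 →L[ℝ] R4) x₀ := by
    have h1 : HasFDerivAt (fun x => T.symm (x - x₀)) (T.symm : R4 →L[ℝ] R4) x₀ := by
      have := (T.symm : R4 →L[ℝ] R4).hasFDerivAt.comp x₀ ((hasFDerivAt_id x₀).sub_const x₀)
      exact this
    have h2 : HasFDerivAt (fun x => T.symm (x - x₀) 1)
        (EuclideanSpace.proj (𝕜 := ℝ) (1 : Fin 4) ∘L (T.symm : R4 →L[ℝ] R4)) x₀ :=
      (EuclideanSpace.proj (𝕜 := ℝ) (1 : Fin 4)).hasFDerivAt.comp x₀ h1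
    refine (h1.add (((hfd.sub_const (f x₀)).sub h2).smul_const
      (EuclideanSpace.single (1 : Fin 4) (1 : ℝ)))).congr_fderiv ?_
    refine ContinuousLinearMap.ext fun x => ?_
    have h3 := hTf (T.symm x)
    rw [T.apply_symm_apply] at h3
    simp [h3]
  obtain ⟨e, hxe, heχ, -, -, hes⟩ := exists_smooth_localHomeomorph hχs hχd univ_mem
  have h0e : (0 : R4) ∈ e.target := by
    rw [← hχ0, ← heχ]; exact e.map_source hxe
  have hσ0 : e.symm 0 = x₀ := by rw [← hχ0, ← heχ, e.left_inv hxe]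
  have hσd : HasFDerivAt e.symm (T : R4 →L[ℝ] R4) 0 := by
    refine e.hasFDerivAt_symm (f' := T.symm) h0e ?_
    rw [hσ0]
    exact hχd.congr_of_eventuallyEq (Eventually.of_forall heχ)
  -- the slice through `x₀` and the coordinates obtained by flowing off it
  let P : R4 →L[ℝ] R4 := ContinuousLinearMap.id ℝ R4 -
    (EuclideanSpace.proj (𝕜 := ℝ) (0 : Fin 4)).smulRight (EuclideanSpace.single 0 1)
  have hP : ∀ y, P y = y - y 0 • EuclideanSpace.single 0 1 := fun y => rfl
  let Q : R4 → ℝ × R4 := fun y => (y 0, e.symm (P y))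
  have hQ0 : Q 0 = (0, x₀) := by simp [Q, hσ0]
  have hPt : ∀ᶠ y in 𝓝 (0 : R4), P y ∈ e.target :=
    P.continuous.continuousAt.eventually (by rw [map_zero]; exact e.open_target.mem_nhds h0e)
  have hQs : ∀ᶠ y in 𝓝 (0 : R4), ContDiffAt ℝ ∞ Q y := by
    filter_upwards [hPt] with y hy
    exact ((EuclideanSpace.proj (𝕜 := ℝ) (0 : Fin 4)).contDiff.contDiffAt).prodMk
      ((hes _ hy).comp y P.contDiff.contDiffAt)
  have hQc : Tendsto Q (𝓝 0) (𝓝 (0, x₀)) := by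
    have := hQs.self_of_nhds.continuousAt
    rwa [ContinuousAt, hQ0] at this
  have hΦx : Φ (0, x₀) = x₀ := hΦ0.self_of_nhds
  have hΨs : ∀ᶠ y in 𝓝 (0 : R4), ContDiffAt ℝ ∞ (fun y => Φ (Q y)) y := by
    filter_upwards [hQs, hQc.eventually hΦs] with y h1 h2
    exact h2.comp y h1
  have hΨ0 : Φ (Q 0) = x₀ := by rw [hQ0, hΦx]
  have hΨc : Tendsto (fun y => Φ (Q y)) (𝓝 0) (𝓝 x₀) := by
    have := hΨs.self_of_nhds.continuousAt
    rwa [ContinuousAt, hΨ0] at this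
  have hΨd : HasFDerivAt (fun y => Φ (Q y)) (T : R4 →L[ℝ] R4) 0 := by
    have hΦd : HasFDerivAt Φ (fderiv ℝ Φ (0, x₀)) (0, x₀) :=
      (hΦs.self_of_nhds.differentiableAt (by simp)).hasFDerivAt
    have hΦ1 : fderiv ℝ Φ (0, x₀) (1, 0) = v x₀ := by
      have h1 : HasDerivAt (fun t : ℝ => ((t, x₀) : ℝ × R4)) (1, 0) 0 :=
        (hasDerivAt_id _).prodMk (hasDerivAt_const _ _)
      have h2 := HasFDerivAt.comp_hasDerivAt (x := (0 : ℝ)) (f := fun t : ℝ => ((t, x₀) : ℝ × R4))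
        hΦd h1
      have h3 := hΦw.self_of_nhds
      rw [hΦx, hwv.self_of_nhds] at h3
      exact h2.unique h3
    have hΦ2 : ∀ ξ, fderiv ℝ Φ (0, x₀) (0, ξ) = ξ := by
      intro ξ
      have h1 : HasFDerivAt (fun x : R4 => ((0, x) : ℝ × R4)) (.inr ℝ ℝ R4) x₀ :=
        hasFDerivAt_prodMk_right _ _
      have h2 := HasFDerivAt.comp (f := fun x : R4 => ((0, x) : ℝ × R4)) x₀ hΦd h1
      have h3 : HasFDerivAt (Φ ∘ fun x : R4 => ((0, x) : ℝ × R4)) (.id ℝ R4) x₀ :=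
        (hasFDerivAt_id x₀).congr_of_eventuallyEq hΦ0
      exact congrArg (fun A : R4 →L[ℝ] R4 => A ξ) (h2.unique h3)
    have hQd : HasFDerivAt Q ((EuclideanSpace.proj (𝕜 := ℝ) (0 : Fin 4)).prod
        ((T : R4 →L[ℝ] R4) ∘L P)) 0 := by
      refine (EuclideanSpace.proj (𝕜 := ℝ) (0 : Fin 4)).hasFDerivAt.prodMk ?_
      refine HasFDerivAt.comp (g := e.symm) (f := P) 0 ?_ P.hasFDerivAt
      rw [map_zero]; exact hσd
    rw [← hQ0] at hΦd
    refine (hΦd.comp 0 hQd).congr_fderiv ?_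
    rw [hQ0]
    refine ContinuousLinearMap.ext fun y => ?_
    have hsplit : ((y 0, T (P y)) : ℝ × R4) = y 0 • ((1, 0) : ℝ × R4) + (0, T (P y)) := by
      ext <;> simp
    change fderiv ℝ Φ (0, x₀) (y 0, T (P y)) = T y
    rw [hsplit, map_add, map_smul, hΦ1, hΦ2, hP, map_sub, map_smul, hTv]
    abel
  have hfΨ : ∀ᶠ y in 𝓝 (0 : R4), f (Φ (Q y)) = f x₀ + y 1 := by
    have hwf : ∀ᶠ x in 𝓝 x₀, fderiv ℝ f x (w x) = 0 := by
      filter_upwards [hvf, hwv] with x h1 h2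
      rw [h2, h1]
    have h1 := eventually_flow_const
      (hf.mono fun x hx => hx.differentiableAt (by simp)) hwf hΦs.self_of_nhds.continuousAt hΦ0 hΦw
    filter_upwards [hQc.eventually h1, hPt] with y hy hyt
    rw [hy]
    have h2 := hχ1 (e.symm (P y))
    rw [← heχ, e.right_inv hyt] at h2
    have h3 : P y 1 = y 1 := by simp [hP]
    change f (e.symm (P y)) = _
    linarith
  have hgood : ∀ᶠ y in 𝓝 (0 : R4), fderiv ℝ (fun y => Φ (Q y)) y (EuclideanSpace.single 0 1) =
      v (Φ (Q y)) ∧ (∀ i, fderiv ℝ (fun y => f (Φ (Q y))) y (EuclideanSpace.single i 1) =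
          if i = 1 then 1 else 0) ∧ Φ (Q y) ∈ s := by
    filter_upwards [hΨs, hQc.eventually hΦw, hfΨ.eventually_nhds, hΨc.eventually hwv,
      hΨc.eventually hs] with y h1 h2 h3 h4 h5
    refine ⟨?_, fun i => ?_, h5⟩
    · have hl : HasDerivAt (fun t : ℝ => y + (t - y 0) • EuclideanSpace.single (0 : Fin 4) (1 : ℝ))
          (EuclideanSpace.single 0 1) (y 0) := by
        simpa using (((hasDerivAt_id (y 0)).sub_const (y 0)).smul_const
          (EuclideanSpace.single (0 : Fin 4) (1 : ℝ))).const_add y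
      have h6 : HasFDerivAt (fun y => Φ (Q y)) (fderiv ℝ (fun y => Φ (Q y)) y)
          (y + (y 0 - y 0) • EuclideanSpace.single (0 : Fin 4) (1 : ℝ)) := by
        rw [sub_self, zero_smul, add_zero]
        exact (h1.differentiableAt (by simp)).hasFDerivAt
      have h7 := HasFDerivAt.comp_hasDerivAt (x := y 0)
        (f := fun t : ℝ => y + (t - y 0) • EuclideanSpace.single (0 : Fin 4) (1 : ℝ)) h6 hl
      have h8 : ((fun y => Φ (Q y)) ∘
          fun t : ℝ => y + (t - y 0) • EuclideanSpace.single (0 : Fin 4) (1 : ℝ)) =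
          fun t => Φ (t, (Q y).2) := by
        funext t
        have h9 : P (y + (t - y 0) • EuclideanSpace.single (0 : Fin 4) (1 : ℝ)) = P y := by
          ext i
          fin_cases i <;> simp [hP]
        simp [Q, h9]
      rw [h8] at h7
      rw [← h4]
      exact h7.unique h2
    · have h6 : HasFDerivAt (fun y : R4 => f x₀ + y 1)
          (EuclideanSpace.proj (𝕜 := ℝ) (1 : Fin 4)) y :=
        (EuclideanSpace.proj (𝕜 := ℝ) (1 : Fin 4)).hasFDerivAt.const_add _
      rw [(h6.congr_of_eventuallyEq h3).fderiv]
      simp [eq_comm]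
  obtain ⟨Ψ, h0Ψ, hΨ, hsub, hΨs', hΨsymm⟩ := exists_smooth_localHomeomorph hΨs hΨd hgood
  have hΨe : (Ψ : R4 → R4) = fun y => Φ (Q y) := funext hΨ
  refine ⟨Ψ, ?_, ?_, ?_, hΨsymm, ?_⟩
  · rw [← hΨ0, ← hΨ]; exact Ψ.map_source h0Ψ
  · intro x hx
    have h := (hsub (Ψ.map_target hx)).2.2
    rwa [← hΨ, Ψ.right_inv hx] at h
  · rw [hΨe]; exact hΨs'
  · intro y hy
    have h := hsub hy
    rw [hΨe]
    exact ⟨h.1, h.2.1⟩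

end FlowBox

section LorentzForm

variable {V : Type*} [AddCommGroup V] [Module ℝ V]

/-- `v` is a nonzero null vector of the symmetric form `B`, it is not in the radical of `B`, and
`B` is negative on vectors orthogonal to `v` that are not multiples of `v`. -/
structure IsNullVector (B : V →ₗ[ℝ] V →ₗ[ℝ] ℝ) (v : V) : Prop where
  symm : ∀ u w, B u w = B w u
  null : B v v = 0
  exists_ne_zero : ∃ w, B v w ≠ 0
  neg_of_orthogonal : ∀ w, B v w = 0 → (∀ c : ℝ, w ≠ c • v) → B w w < 0

theorem lorentz_apply {B : V →ₗ[ℝ] V →ₗ[ℝ] ℝ} {b : Module.Basis (Fin 4) ℝ V}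
    (hb : ∀ i j, B (b i) (b j) = Matrix.diagonal ![(1 : ℝ), -1, -1, -1] i j) (u w : V) :
    B u w = b.repr u 0 * b.repr w 0 - b.repr u 1 * b.repr w 1 - b.repr u 2 * b.repr w 2 -
      b.repr u 3 * b.repr w 3 := by
  conv_lhs => rw [← b.sum_repr u, ← b.sum_repr w]
  simp only [Fin.sum_univ_four, map_add, map_smul, LinearMap.add_apply, LinearMap.smul_apply, hb,
    Matrix.diagonal_apply, smul_eq_mul]
  simp
  ring

theorem isNullVector_of_lorentz {B : V →ₗ[ℝ] V →ₗ[ℝ] ℝ} {b : Module.Basis (Fin 4) ℝ V}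
    (hb : ∀ i j, B (b i) (b j) = Matrix.diagonal ![(1 : ℝ), -1, -1, -1] i j) {v : V}
    (hv : v ≠ 0) (hvv : B v v = 0) : IsNullVector B v := by
  have hB := lorentz_apply hb
  have hneg : ∀ y : V, y ≠ 0 → b.repr y 0 = 0 → B y y < 0 := by
    intro y hy hy0
    rw [hB, hy0]
    by_contra! hcon
    have h1 : b.repr y 1 = 0 := by
      nlinarith [sq_nonneg (b.repr y 1), sq_nonneg (b.repr y 2), sq_nonneg (b.repr y 3)]
    have h2 : b.repr y 2 = 0 := by
      nlinarith [sq_nonneg (b.repr y 1), sq_nonneg (b.repr y 2), sq_nonneg (b.repr y 3)]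
    have h3 : b.repr y 3 = 0 := by
      nlinarith [sq_nonneg (b.repr y 1), sq_nonneg (b.repr y 2), sq_nonneg (b.repr y 3)]
    refine hy (b.repr.map_eq_zero_iff.1 (Finsupp.ext fun i => ?_))
    fin_cases i
    exacts [hy0, h1, h2, h3]
  have hv0 : b.repr v 0 ≠ 0 := fun h => (hneg v hv h).ne hvv
  refine ⟨fun u w => by rw [hB, hB]; ring, hvv, ⟨b 0, ?_⟩, fun w hvw hw => ?_⟩
  · rw [hB]
    simpa using hv0
  · have hy : b.repr v 0 • w - b.repr w 0 • v ≠ 0 := by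
      intro h
      refine hw ((b.repr v 0)⁻¹ * b.repr w 0) ?_
      rw [mul_smul, ← sub_eq_zero.1 h, smul_smul, inv_mul_cancel₀ hv0, one_smul]
    have h1 := hneg _ hy (by simp; ring)
    have hwv : B w v = 0 := by rw [← hvw, hB, hB]; ring
    simp only [map_sub, map_smul, LinearMap.sub_apply, LinearMap.smul_apply, smul_eq_mul, hvv, hvw,
      hwv] at h1
    nlinarith [sq_nonneg (b.repr v 0), mul_self_pos.2 hv0]

end LorentzForm

section FundamentalTensor

variable {M : Type*} [TopologicalSpace M] [ChartedSpace R4 M]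

theorem fundTensor_neg (L : TangentBundle (𝓡 4) M → ℝ) {p : M} (v u w : TangentSpace (𝓡 4) p) :
    fundTensor (-L) v u w = -fundTensor L v u w := by
  simp only [fundTensor, Pi.neg_apply, deriv.fun_neg]
  ring

theorem fundTensor_self {L : TangentBundle (𝓡 4) M → ℝ} {p : M} {v : TangentSpace (𝓡 4) p}
    (hL : ∀ c : ℝ, 0 < c → L ⟨p, c • v⟩ = c ^ 2 * L ⟨p, v⟩) (hv : L ⟨p, v⟩ = 0) :
    fundTensor L v v v = 0 := by
  have hinner : (fun s : ℝ => deriv (fun t : ℝ => L ⟨p, v + t • v + s • v⟩) 0) =ᶠ[𝓝 0]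
      fun _ => 0 := by
    filter_upwards [Ioi_mem_nhds (show (-1 : ℝ) < 0 by norm_num)] with s hs
    have h0 : (fun t : ℝ => L ⟨p, v + t • v + s • v⟩) =ᶠ[𝓝 0] fun _ => 0 := by
      have hc : ContinuousAt (fun t : ℝ => 1 + t + s) 0 := by fun_prop
      filter_upwards [hc.eventually (Ioi_mem_nhds (show (0 : ℝ) < 1 + 0 + s by
        have : -1 < s := hs
        linarith))] with t ht
      have h1 : v + t • v + s • v = (1 + t + s) • v := by rw [add_smul, add_smul, one_smul]
      rw [h1, hL _ ht, hv, mul_zero]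
    rw [h0.deriv_eq, deriv_const]
  rw [fundTensor, hinner.deriv_eq, deriv_const, mul_zero]

variable [IsManifold (𝓡 4) ∞ M]

/-- The inclusion of a tangent space into the tangent bundle is smooth. -/
theorem contMDiff_tangentSpace_mk (p : M) :
    ContMDiff 𝓘(ℝ, R4) (𝓡 4).tangent ∞
      (fun v : R4 => (⟨p, (v : TangentSpace (𝓡 4) p)⟩ : TangentBundle (𝓡 4) M)) := by
  intro v
  refine (Bundle.contMDiffAt_totalSpace (F := R4) (E := fun x : M => TangentSpace (𝓡 4) x)).2
    ⟨contMDiffAt_const, ?_⟩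
  set e := trivializationAt R4 (fun x : M => TangentSpace (𝓡 4) x) p
  have hp : p ∈ e.baseSet := FiberBundle.mem_baseSet_trivializationAt' p
  have h : (fun v : R4 => (e ⟨p, (v : TangentSpace (𝓡 4) p)⟩).2) =
      fun v : R4 => (e.continuousLinearMapAt ℝ p : R4 →L[ℝ] R4) v := by
    funext v
    exact (congrFun (e.coe_linearMapAt_of_mem (R := ℝ) hp) v).symm
  change ContMDiffAt 𝓘(ℝ, R4) 𝓘(ℝ, R4) ∞ (fun v : R4 => (e ⟨p, (v : TangentSpace (𝓡 4) p)⟩).2) v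
  rw [h]
  exact (ContinuousLinearMap.contDiff _).contMDiff.contMDiffAt

theorem contDiffAt_fiber {L : TangentBundle (𝓡 4) M → ℝ} {O : Set (TangentBundle (𝓡 4) M)}
    (hO : IsOpen O) (hL : ContMDiffOn (𝓡 4).tangent 𝓘(ℝ, ℝ) ∞ L O) {p : M}
    {v : TangentSpace (𝓡 4) p} (hv : (⟨p, v⟩ : TangentBundle (𝓡 4) M) ∈ O) :
    ContDiffAt ℝ ∞ (fun u : R4 => L ⟨p, u⟩) (v : R4) := by
  have h1 : ContMDiffAt (𝓡 4).tangent 𝓘(ℝ, ℝ) ∞ L (⟨p, v⟩ : TangentBundle (𝓡 4) M) :=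
    hL.contMDiffAt (hO.mem_nhds hv)
  exact (ContMDiffAt.comp (g := L)
    (f := fun u : R4 => (⟨p, (u : TangentSpace (𝓡 4) p)⟩ : TangentBundle (𝓡 4) M)) (v : R4) h1
    (contMDiff_tangentSpace_mk p (v : R4))).contDiffAt

theorem deriv_deriv_eq_fderiv_fderiv {E : Type*} [NormedAddCommGroup E] [NormedSpace ℝ E]
    {F : E → ℝ} {v : E} (hF : ContDiffAt ℝ ∞ F v) (u w : E) :
    deriv (fun s : ℝ => deriv (fun t : ℝ => F (v + t • u + s • w)) 0) 0 =
      fderiv ℝ (fderiv ℝ F) v w u := by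
  have hline : ∀ a b : E, HasDerivAt (fun t : ℝ => a + t • b) b 0 := fun a b => by
    simpa using ((hasDerivAt_id (0 : ℝ)).smul_const b).const_add a
  have hev : ∀ᶠ x in 𝓝 v, DifferentiableAt ℝ F x :=
    ((hF.of_le (m := 1) (by simp)).eventually (by simp)).mono
      fun x hx => hx.differentiableAt (by simp)
  have hlim : Tendsto (fun s : ℝ => v + s • w) (𝓝 0) (𝓝 v) := by
    simpa using (hline v w).continuousAt.tendsto
  have hinner : (fun s : ℝ => deriv (fun t : ℝ => F (v + t • u + s • w)) 0) =ᶠ[𝓝 0]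
      fun s => fderiv ℝ F (v + s • w) u := by
    filter_upwards [hlim.eventually hev] with s hs
    have h1 : HasDerivAt (fun t : ℝ => v + t • u + s • w) u 0 := by
      simpa [add_right_comm] using hline (v + s • w) u
    have h2 : HasFDerivAt F (fderiv ℝ F (v + s • w)) (v + (0 : ℝ) • u + s • w) := by
      simpa using hs.hasFDerivAt
    exact (HasFDerivAt.comp_hasDerivAt (x := (0 : ℝ)) (f := fun t : ℝ => v + t • u + s • w)
      h2 h1).deriv
  rw [hinner.deriv_eq]
  have h3 : HasFDerivAt (fderiv ℝ F) (fderiv ℝ (fderiv ℝ F) v) (v + (0 : ℝ) • w) := by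
    have h4 : ContDiffAt ℝ ∞ (fderiv ℝ F) v := hF.fderiv_right (by simp)
    simpa using (h4.differentiableAt (by simp)).hasFDerivAt
  have h5 := HasFDerivAt.comp_hasDerivAt (x := (0 : ℝ)) (f := fun s : ℝ => v + s • w)
    h3 (hline v w)
  exact (h5.clm_apply (hasDerivAt_const (0 : ℝ) u)).deriv.trans (by simp)

/-- The fundamental tensor as a bilinear map. -/
theorem exists_bilinear_fundTensor {L : TangentBundle (𝓡 4) M → ℝ}
    {O : Set (TangentBundle (𝓡 4) M)} (hO : IsOpen O)
    (hL : ContMDiffOn (𝓡 4).tangent 𝓘(ℝ, ℝ) ∞ L O) {p : M} {v : TangentSpace (𝓡 4) p}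
    (hv : (⟨p, v⟩ : TangentBundle (𝓡 4) M) ∈ O) :
    ∃ B : TangentSpace (𝓡 4) p →ₗ[ℝ] TangentSpace (𝓡 4) p →ₗ[ℝ] ℝ,
      ∀ u w, fundTensor L v u w = B u w := by
  let D : R4 →L[ℝ] R4 →L[ℝ] ℝ := fderiv ℝ (fderiv ℝ fun u : R4 => L ⟨p, u⟩) (v : R4)
  let B : R4 →ₗ[ℝ] R4 →ₗ[ℝ] ℝ := LinearMap.mk₂ ℝ (fun u w => (1 / 2) * D w u)
    (fun _ _ _ => by simp [mul_add]) (fun c _ _ => by simp; ring)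
    (fun _ _ _ => by simp [mul_add]) (fun c _ _ => by simp; ring)
  refine ⟨B, fun u w => ?_⟩
  have h := deriv_deriv_eq_fderiv_fderiv (contDiffAt_fiber hO hL hv) (u : R4) (w : R4)
  exact congrArg (fun x : ℝ => (1 / 2) * x) h

theorem IsFinslerSpacetime.exists_isNullVector {A : Set (TangentBundle (𝓡 4) M)}
    {L : TangentBundle (𝓡 4) M → ℝ} (h : IsFinslerSpacetime A L) {p : M}
    {v : TangentSpace (𝓡 4) p} (hvA : (⟨p, v⟩ : TangentBundle (𝓡 4) M) ∈ slitClosure A)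
    (hv : v ≠ 0) (hLv : L ⟨p, v⟩ = 0) :
    ∃ B : TangentSpace (𝓡 4) p →ₗ[ℝ] TangentSpace (𝓡 4) p →ₗ[ℝ] ℝ,
      (∀ u w, fundTensor L v u w = B u w) ∧ IsNullVector B v := by
  obtain ⟨O, hO, hAO, hL⟩ := h.smooth
  obtain ⟨B, hB⟩ := exists_bilinear_fundTensor hO hL (hAO hvA)
  obtain ⟨b, hb⟩ := h.signature p v hvA
  refine ⟨B, hB, isNullVector_of_lorentz (b := b) (fun i j => by rw [← hB, hb]) hv ?_⟩
  rw [← hB]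
  exact fundTensor_self (fun c hc => h.homogeneous p v c hc hvA) hLv

end FundamentalTensor

section LightlikeChart

variable {M : Type*} [TopologicalSpace M] [ChartedSpace R4 M]

theorem mfderiv_symm_apply_mfderiv {φ : OpenPartialHomeomorph M R4}
    (hφ : φ ∈ IsManifold.maximalAtlas (𝓡 4) ∞ M) {q : M} (hq : q ∈ φ.source)
    (X : TangentSpace (𝓡 4) q) :
    mfderiv (𝓡 4) (𝓡 4) φ.symm (φ q) (mfderiv (𝓡 4) (𝓡 4) φ q X) = X := by
  have h : φ.MDifferentiable (𝓡 4) (𝓡 4) :=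
    ⟨(contMDiffOn_of_mem_maximalAtlas hφ).mdifferentiableOn (by simp),
      (contMDiffOn_symm_of_mem_maximalAtlas hφ).mdifferentiableOn (by simp)⟩
  exact congrArg (fun B : TangentSpace (𝓡 4) q →L[ℝ] TangentSpace (𝓡 4) q => B X)
    (h.symm_comp_deriv hq)

theorem mfderiv_symm_injective {φ : OpenPartialHomeomorph M R4}
    (hφ : φ ∈ IsManifold.maximalAtlas (𝓡 4) ∞ M) {q : M} (hq : q ∈ φ.source) :
    Function.Injective (mfderiv (𝓡 4) (𝓡 4) φ.symm (φ q)) := by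
  have h : φ.MDifferentiable (𝓡 4) (𝓡 4) :=
    ⟨(contMDiffOn_of_mem_maximalAtlas hφ).mdifferentiableOn (by simp),
      (contMDiffOn_symm_of_mem_maximalAtlas hφ).mdifferentiableOn (by simp)⟩
  exact h.symm.mfderiv_injective (φ.map_source hq)

variable [IsManifold (𝓡 4) ∞ M]

theorem contMDiffAt_mfderiv_chartAt {U : Set M} (hU : IsOpen U)
    {N : (p : M) → TangentSpace (𝓡 4) p}
    (hN : ContMDiffOn (𝓡 4) (𝓡 4).tangent ∞ (fun p => (⟨p, N p⟩ : TangentBundle (𝓡 4) M)) U)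
    (p : M) {q : M} (hq : q ∈ (chartAt R4 p).source) (hqU : q ∈ U) :
    ContMDiffAt (𝓡 4) 𝓘(ℝ, R4) ∞
      (fun q => (mfderiv (𝓡 4) (𝓡 4) (chartAt R4 p) q (N q) : R4)) q := by
  set e := trivializationAt R4 (fun x : M => TangentSpace (𝓡 4) x) p with he
  have hbase : e.baseSet = (chartAt R4 p).source := TangentBundle.trivializationAt_baseSet p
  have h1 := (e.contMDiffAt_section_iff (IB := 𝓡 4) (n := ∞) (s := N) (x₀ := q)
    (by rw [hbase]; exact hq)).1 (hN.contMDiffAt (hU.mem_nhds hqU))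
  refine h1.congr_of_eventuallyEq ?_
  filter_upwards [(chartAt R4 p).open_source.mem_nhds hq] with x hx
  have h2 := congrFun (e.coe_linearMapAt_of_mem (R := ℝ) (by rw [hbase]; exact hx)) (N x)
  have h3 := TangentBundle.continuousLinearMapAt_trivializationAt (I := 𝓡 4) (x₀ := p) hx
  rw [← h2]
  exact (congrArg (fun B : TangentSpace (𝓡 4) x →L[ℝ] R4 => B (N x)) h3).symm

/-- Coordinates adapted to a vector field and to a function annihilated by it. -/
theorem exists_adapted_chart {U : Set M} (hU : IsOpen U) {f : M → ℝ}
    (hf : ContMDiffOn (𝓡 4) 𝓘(ℝ, ℝ) ∞ f U) {N : (p : M) → TangentSpace (𝓡 4) p}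
    (hN : ContMDiffOn (𝓡 4) (𝓡 4).tangent ∞ (fun p => (⟨p, N p⟩ : TangentBundle (𝓡 4) M)) U)
    (hfN : ∀ q ∈ U, mfderiv (𝓡 4) 𝓘(ℝ, ℝ) f q (N q) = 0) {p : M} (hp : p ∈ U) (hNp : N p ≠ 0)
    (hfp : ∃ X, mfderiv (𝓡 4) 𝓘(ℝ, ℝ) f p X ≠ 0) :
    ∃ φ ∈ IsManifold.maximalAtlas (𝓡 4) ∞ M, p ∈ φ.source ∧ φ.source ⊆ U ∧
      ∀ q ∈ φ.source, N q = coordVec φ 0 q ∧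
        ∀ i, mfderiv (𝓡 4) 𝓘(ℝ, ℝ) f q (coordVec φ i q) = if i = 1 then (1 : ℝ) else 0 := by
  set e := chartAt R4 p with he
  have heA : e ∈ IsManifold.maximalAtlas (𝓡 4) ∞ M := IsManifold.chart_mem_maximalAtlas p
  have hpe : p ∈ e.source := mem_chart_source R4 p
  have hes : ∀ x ∈ e.target, ContMDiffAt (𝓡 4) (𝓡 4) ∞ e.symm x := fun x hx =>
    contMDiffAt_symm_of_mem_maximalAtlas heA hx
  have hfU : ∀ q ∈ U, ContMDiffAt (𝓡 4) 𝓘(ℝ, ℝ) ∞ f q := fun q hq =>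
    hf.contMDiffAt (hU.mem_nhds hq)
  have hfd : ∀ q ∈ U, MDifferentiableAt (𝓡 4) 𝓘(ℝ, ℝ) f q := fun q hq =>
    (hfU q hq).mdifferentiableAt (by simp)
  let v : R4 → R4 := fun x => mfderiv (𝓡 4) (𝓡 4) e (e.symm x) (N (e.symm x))
  have hv : ∀ q ∈ e.source, v (e q) = mfderiv (𝓡 4) (𝓡 4) e q (N q) := by
    have aux : ∀ q q' : M, q' = q → (mfderiv (𝓡 4) (𝓡 4) e q' (N q') : R4) =
        mfderiv (𝓡 4) (𝓡 4) e q (N q) := by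
      rintro q _ rfl
      rfl
    exact fun q hq => aux _ _ (e.left_inv hq)
  have hchain : ∀ q ∈ e.source, q ∈ U → ∀ X : R4,
      fderiv ℝ (fun x => f (e.symm x)) (e q) X =
        mfderiv (𝓡 4) 𝓘(ℝ, ℝ) f q (mfderiv (𝓡 4) (𝓡 4) e.symm (e q) X) := by
    intro q hq hqU X
    have h1 := mfderiv_comp_of_eq (x := e q) (f := e.symm) (g := f) (hfd q hqU)
      ((hes _ (e.map_source hq)).mdifferentiableAt (by simp)) (e.left_inv hq)
    have haux : ∀ a b : M, a = b → (mfderiv (𝓡 4) 𝓘(ℝ, ℝ) f a : R4 →L[ℝ] ℝ) =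
        mfderiv (𝓡 4) 𝓘(ℝ, ℝ) f b := by
      rintro a _ rfl
      rfl
    have h2 : (mfderiv (𝓡 4) 𝓘(ℝ, ℝ) f (e.symm (e q)) : R4 →L[ℝ] ℝ) =
        mfderiv (𝓡 4) 𝓘(ℝ, ℝ) f q :=
      haux _ _ (e.left_inv hq)
    rw [← mfderiv_eq_fderiv]
    exact (congrArg (fun B : R4 →L[ℝ] ℝ => B X) h1).trans
      (congrArg (fun B : R4 →L[ℝ] ℝ => B (mfderiv (𝓡 4) (𝓡 4) e.symm (e q) X)) h2)
  have hW : e.target ∩ e.symm ⁻¹' U ∈ 𝓝 (e p) := by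
    refine (e.symm.isOpen_inter_preimage hU).mem_nhds ⟨e.map_source hpe, ?_⟩
    rwa [mem_preimage, e.left_inv hpe]
  have hvs : ∀ᶠ x in 𝓝 (e p), ContDiffAt ℝ ∞ v x := by
    filter_upwards [hW] with x hx
    have h1 := contMDiffAt_mfderiv_chartAt hU hN p (e.map_target hx.1) hx.2
    exact (ContMDiffAt.comp (f := e.symm) x h1 (hes x hx.1)).contDiffAt
  have hfs : ∀ᶠ x in 𝓝 (e p), ContDiffAt ℝ ∞ (fun x => f (e.symm x)) x := by
    filter_upwards [hW] with x hx
    exact (ContMDiffAt.comp (f := e.symm) x (hfU _ hx.2) (hes x hx.1)).contDiffAt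
  have hvf : ∀ᶠ x in 𝓝 (e p), fderiv ℝ (fun x => f (e.symm x)) x (v x) = 0 := by
    filter_upwards [hW] with x hx
    have hq : e.symm x ∈ e.source := e.map_target hx.1
    have h1 := hchain _ hq hx.2 (v (e (e.symm x)))
    rw [hv _ hq, mfderiv_symm_apply_mfderiv heA hq, hfN _ hx.2, ← hv _ hq, e.right_inv hx.1] at h1
    exact h1
  have hv0 : v (e p) ≠ 0 := by
    intro h
    apply hNp
    rw [← mfderiv_symm_apply_mfderiv heA hpe (N p), ← hv p hpe, h]
    exact map_zero _
  have hf0 : fderiv ℝ (fun x => f (e.symm x)) (e p) ≠ 0 := by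
    obtain ⟨X, hX⟩ := hfp
    intro h
    apply hX
    have h1 := hchain p hpe hp (mfderiv (𝓡 4) (𝓡 4) e p X)
    rw [mfderiv_symm_apply_mfderiv heA hpe, h] at h1
    exact h1.symm
  obtain ⟨Ψ, hpΨ, hΨW, hΨs, hΨsymm, hΨ⟩ := exists_rectification hvs hfs hvf hv0 hf0 hW
  let φ : OpenPartialHomeomorph M R4 := e.trans Ψ.symm
  have hφsource : ∀ q, q ∈ φ.source ↔ q ∈ e.source ∧ e q ∈ Ψ.target := fun q => by simp [φ]
  have hφU : φ.source ⊆ U := by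
    intro q hq
    obtain ⟨h1, h2⟩ := (hφsource q).1 hq
    have h3 := (hΨW h2).2
    rwa [mem_preimage, e.left_inv h1] at h3
  refine ⟨φ, ?_, (hφsource p).2 ⟨hpe, hpΨ⟩, hφU, fun q hq => ?_⟩
  · refine φ.mem_maximalAtlas_of_contMDiffOn (fun q hq => ?_) (fun y hy => ?_)
    · obtain ⟨h1, h2⟩ := (hφsource q).1 hq
      exact (ContMDiffAt.comp (f := e) q (hΨsymm _ h2).contMDiffAt
        (contMDiffAt_of_mem_maximalAtlas heA h1)).contMDiffWithinAt
    · have hy' : y ∈ Ψ.source ∧ Ψ y ∈ e.target := by simpa [φ] using hy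
      exact (ContMDiffAt.comp (f := Ψ) y (hes _ hy'.2)
        (hΨs _ hy'.1).contMDiffAt).contMDiffWithinAt
  · obtain ⟨hqe, hqΨ⟩ := (hφsource q).1 hq
    have hqU : q ∈ U := hφU hq
    set y : R4 := Ψ.symm (e q) with hy
    have hyΨ : y ∈ Ψ.source := Ψ.map_target hqΨ
    have hΨy : Ψ y = e q := Ψ.right_inv hqΨ
    have hΨd : MDifferentiableAt (𝓡 4) (𝓡 4) Ψ y :=
      (hΨs y hyΨ).contMDiffAt.mdifferentiableAt (by simp)
    have hcoord : ∀ i, coordVec φ i q = mfderiv (𝓡 4) (𝓡 4) e.symm (e q)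
        (fderiv ℝ Ψ y (EuclideanSpace.single i 1)) := by
      intro i
      have h1 := mfderiv_comp_of_eq (x := y) (f := Ψ) (g := e.symm)
        ((hes (e q) (e.map_source hqe)).mdifferentiableAt (by simp)) hΨd hΨy
      have haux : ∀ a b : R4, a = b → (mfderiv (𝓡 4) (𝓡 4) e.symm a : R4 →L[ℝ] R4) =
          mfderiv (𝓡 4) (𝓡 4) e.symm b := by
        rintro a _ rfl
        rfl
      have h2 : (mfderiv (𝓡 4) (𝓡 4) e.symm (Ψ y) : R4 →L[ℝ] R4) =
          mfderiv (𝓡 4) (𝓡 4) e.symm (e q) :=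
        haux _ _ hΨy
      rw [← mfderiv_eq_fderiv]
      exact (congrArg (fun B : R4 →L[ℝ] R4 => B (EuclideanSpace.single i 1)) h1).trans
        (congrArg (fun B : R4 →L[ℝ] R4 =>
          B (mfderiv (𝓡 4) (𝓡 4) Ψ y (EuclideanSpace.single i 1))) h2)
    refine ⟨?_, fun i => ?_⟩
    · rw [hcoord, (hΨ y hyΨ).1, hΨy, hv q hqe, mfderiv_symm_apply_mfderiv heA hqe]
    · rw [hcoord, ← hchain q hqe hqU, ← (hΨ y hyΨ).2 i]
      have hfe : HasFDerivAt (fun x => f (e.symm x)) (fderiv ℝ (fun x => f (e.symm x)) (e q))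
          (Ψ y) := by
        rw [hΨy]
        refine (ContDiffAt.differentiableAt (n := ∞) ?_ (by simp)).hasFDerivAt
        exact (ContMDiffAt.comp (f := e.symm) (e q) (by rw [e.left_inv hqe]; exact hfU q hqU)
          (hes _ (e.map_source hqe))).contDiffAt
      have hΨf : HasFDerivAt Ψ (fderiv ℝ Ψ y) y :=
        ((hΨs y hyΨ).differentiableAt (by simp)).hasFDerivAt
      exact (congrArg (fun B : R4 →L[ℝ] ℝ => B (EuclideanSpace.single i 1))
        (hfe.comp y hΨf).fderiv).symm

/-- Lightlike coordinates, when `g_N = σ B` with `B` of signature `(+,-,-,-)`. -/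
theorem exists_isLightlikeChart {L : TangentBundle (𝓡 4) M → ℝ} {U : Set M} (hU : IsOpen U)
    {f : M → ℝ} (hf : ContMDiffOn (𝓡 4) 𝓘(ℝ, ℝ) ∞ f U) {N : (p : M) → TangentSpace (𝓡 4) p}
    {A : Set (TangentBundle (𝓡 4) M)} (hgrad : IsGradientOn A L f U N)
    (hlight : IsLightlikeOn L U N) {σ : ℝ} (hσ : σ ≠ 0)
    (hB : ∀ q ∈ U, ∃ B : TangentSpace (𝓡 4) q →ₗ[ℝ] TangentSpace (𝓡 4) q →ₗ[ℝ] ℝ,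
      (∀ u w, fundTensor L (N q) u w = σ * B u w) ∧ IsNullVector B (N q))
    {p : M} (hp : p ∈ U) :
    ∃ φ : OpenPartialHomeomorph M R4, IsLightlikeChart L U N p φ ∧
      ∀ q ∈ φ.source, ((-σ) • transverseBlock (metricMatrix L N φ q)).PosDef := by
  have hfN : ∀ q ∈ U, mfderiv (𝓡 4) 𝓘(ℝ, ℝ) f q (N q) = 0 := by
    intro q hq
    obtain ⟨B, hBg, hBN⟩ := hB q hq
    rw [← hgrad.metric_eq q hq, hBg, hBN.null, mul_zero]
    rfl
  have hfp : ∃ X, mfderiv (𝓡 4) 𝓘(ℝ, ℝ) f p X ≠ 0 := by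
    obtain ⟨B, hBg, hBN⟩ := hB p hp
    obtain ⟨X, hX⟩ := hBN.exists_ne_zero
    refine ⟨X, ?_⟩
    have h : σ * B (N p) X ≠ 0 := mul_ne_zero hσ hX
    rw [← hgrad.metric_eq p hp, hBg]
    exact h
  obtain ⟨φ, hφA, hpφ, hφU, hφ⟩ := exists_adapted_chart hU hf hgrad.smooth hfN hp
    (hlight p hp).1 hfp
  have hrow : ∀ q ∈ φ.source, ∀ i, fundTensor L (N q) (N q) (coordVec φ i q) =
      if i = 1 then (1 : ℝ) else 0 := fun q hq i => by
    rw [hgrad.metric_eq q (hφU hq), (hφ q hq).2]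
  refine ⟨φ, ⟨hφA, hpφ, hφU, fun q hq => (hφ q hq).1, fun q hq => ?_⟩, fun q hq => ?_⟩
  · obtain ⟨B, hBg, hBN⟩ := hB q (hφU hq)
    have h0 : ∀ i, metricMatrix L N φ q 0 i = if i = 1 then (1 : ℝ) else 0 := fun i => by
      rw [← hrow q hq i, metricMatrix, Matrix.of_apply, ← (hφ q hq).1]
    have h1 : ∀ i j, metricMatrix L N φ q i j = metricMatrix L N φ q j i := fun i j => by
      rw [metricMatrix, Matrix.of_apply, Matrix.of_apply, hBg, hBg, hBN.symm]
    ext i j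
    fin_cases i <;> fin_cases j <;> simp [h0, h1 _ 0]
  · obtain ⟨B, hBg, hBN⟩ := hB q (hφU hq)
    have hG : ∀ i j, metricMatrix L N φ q i j = σ * B (coordVec φ i q) (coordVec φ j q) :=
      fun i j => hBg _ _
    have hperp : ∀ i, i ≠ 1 → B (N q) (coordVec φ i q) = 0 := fun i hi => by
      have h := hrow q hq i
      rw [hBg, if_neg hi] at h
      exact (mul_eq_zero.1 h).resolve_left hσ
    refine Matrix.PosDef.of_dotProduct_mulVec_pos ?_ fun x hx => ?_
    · ext i j
      fin_cases i <;> fin_cases j <;> simp [transverseBlock, hG, hBN.symm]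
    · set X := x 0 • coordVec φ 2 q + x 1 • coordVec φ 3 q with hX
      have hXN : B (N q) X = 0 := by
        rw [hX, map_add, map_smul, map_smul, hperp 2 (by decide), hperp 3 (by decide)]
        simp
      have hXc : ∀ c : ℝ, X ≠ c • N q := by
        intro c hc
        apply hx
        have h1 : mfderiv (𝓡 4) (𝓡 4) φ.symm (φ q)
            (x 0 • EuclideanSpace.single 2 1 + x 1 • EuclideanSpace.single 3 1 : R4) =
            mfderiv (𝓡 4) (𝓡 4) φ.symm (φ q) (c • EuclideanSpace.single 0 1 : R4) := by
          have hN0 := (hφ q hq).1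
          rw [hX, hN0] at hc
          refine ((map_add _ _ _).trans ?_).trans ((map_smul _ c _).symm)
          refine Eq.trans ?_ hc
          exact congrArg₂ (· + ·) (map_smul _ (x 0) _) (map_smul _ (x 1) _)
        have h2 : (x 0 • EuclideanSpace.single 2 1 + x 1 • EuclideanSpace.single 3 1 : R4) =
            c • EuclideanSpace.single 0 1 := mfderiv_symm_injective hφA hq h1
        have h3 := congrArg (fun z : R4 => z 2) h2
        have h4 := congrArg (fun z : R4 => z 3) h2
        ext i
        fin_cases i
        · simpa using h3
        · simpa using h4
      have hneg := hBN.neg_of_orthogonal X hXN hXc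
      have hquad : star x ⬝ᵥ (((-σ) • transverseBlock (metricMatrix L N φ q)) *ᵥ x) =
          σ ^ 2 * -B X X := by
        simp only [hX, map_add, map_smul, LinearMap.add_apply, LinearMap.smul_apply, smul_eq_mul]
        simp [transverseBlock, hG, dotProduct, Matrix.mulVec, Fin.sum_univ_two]
        ring
      rw [hquad]
      have : 0 < σ ^ 2 := by positivity
      nlinarith

end LightlikeChart

/-- Lightlike coordinates, in both signature conventions. The first part is for `L ≥ 0` on `Ā` and
`g` of signature `(+,-,-,-)`; the transverse block is then negative definite. The second part is
for `L ≤ 0` on `Ā` and `g` of signature `(-,+,+,+)`, that is, `-L` is as in the first part;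
the transverse block is then positive definite. In each part the gradient and the matrix are
those of `L` itself. -/
theorem lemma3p1 {M : Type*} [TopologicalSpace M] [ChartedSpace R4 M] [IsManifold (𝓡 4) ∞ M]
    (A : Set (TangentBundle (𝓡 4) M)) (L : TangentBundle (𝓡 4) M → ℝ)
    (U : Set M) (hU : IsOpen U) (f : M → ℝ) (hf : ContMDiffOn (𝓡 4) 𝓘(ℝ, ℝ) ∞ f U)
    (N : (p : M) → TangentSpace (𝓡 4) p)
    (hgrad : IsGradientOn A L f U N) (hlight : IsLightlikeOn L U N) :
    (IsFinslerSpacetime A L → ∀ p ∈ U, ∃ φ : OpenPartialHomeomorph M R4,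
      IsLightlikeChart L U N p φ ∧
        ∀ q ∈ φ.source, (-transverseBlock (metricMatrix L N φ q)).PosDef) ∧
    (IsFinslerSpacetime A (-L) → ∀ p ∈ U, ∃ φ : OpenPartialHomeomorph M R4,
      IsLightlikeChart L U N p φ ∧
        ∀ q ∈ φ.source, (transverseBlock (metricMatrix L N φ q)).PosDef) := by
  refine ⟨fun hL p hp => ?_, fun hL p hp => ?_⟩
  · obtain ⟨φ, h1, h2⟩ := exists_isLightlikeChart (σ := 1) hU hf hgrad hlight one_ne_zero
      (fun q hq => by
        obtain ⟨B, hB, hBN⟩ := hL.exists_isNullVector (hgrad.admissible q hq) (hlight q hq).1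
          (hlight q hq).2
        exact ⟨B, fun u w => by rw [hB, one_mul], hBN⟩) hp
    exact ⟨φ, h1, fun q hq => by simpa using h2 q hq⟩
  · obtain ⟨φ, h1, h2⟩ := exists_isLightlikeChart (σ := -1) hU hf hgrad hlight (by norm_num)
      (fun q hq => by
        obtain ⟨B, hB, hBN⟩ := hL.exists_isNullVector (hgrad.admissible q hq) (hlight q hq).1
          (by simp [(hlight q hq).2])
        exact ⟨B, fun u w => by rw [← hB, fundTensor_neg, neg_one_mul, neg_neg], hBN⟩) hp
    exact ⟨φ, h1, fun q hq => by simpa using h2 q hq⟩
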